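/- Let $\Gamma=(\Gamma^0,\Gamma^1,\mathbf s,\mathbf r)$ be a directed graph, consisting of arbitrary sets $\Gamma^0$ of vertices and $\Gamma^1$ of edges, and of source and range functions $\mathbf s,\mathbf r\colon\Gamma^1\to\Gamma^0$. The graph inverse semigroup $S(\Gamma)$ is the semigroup with zero $0$ generated by $\Gamma^0\sqcup\Gamma^1\sqcup\{e^{-1}\mid e\in\Gamma^1\}$ subject to the following relations, for all $u,v\in\Gamma^0$ and $e,f\in\Gamma^1$: $vv=v$, and $vu=0$ if $v\neq u$; $\mathbf s(e)\,e=e\,\mathbf r(e)=e$; $\mathbf r(e)\,e^{-1}=e^{-1}\,\mathbf s(e)=e^{-1}$; $f^{-1}f=\mathbf r(f)$, and $e^{-1}f=0$ if $e\neq f$. It is an inverse semigroup. An inverse semigroup $S$ is called $E$-disjunctive if equality is the only congruence $\rho$ on $S$ that is idempotent-pure, that is, such that $(s,e)\in\rho$ with $e$ idempotent implies that $s$ is idempotent. A vertex is isolated if it is neither the source nor the range of an edge, and an out-edge of a vertex $v$ is an edge $e$ with $\mathbf s(e)=v$. **Theorem.** The graph inverse semigroup $S(\Gamma)$ is $E$-disjunctive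 if and only if $\Gamma$ has no isolated vertices and every vertex of $\Gamma$ has either $0$ or at least $2$ out-edges. -/

import Mathlib

universe u v

/-- An inverse semigroup: every element `a` has a unique inverse, that is, a unique `b` with
`a * b * a = a` and `b * a * b = b`. -/
class IsInverseSemigroup (S : Type*) [Semigroup S] : Prop where
  existsUnique_inverse : ∀ a : S, ∃! b : S, a * b * a = a ∧ b * a * b = b

/-- A congruence is idempotent-pure if only idempotents are related to idempotents. -/
def Con.IsIdempotentPure {S : Type*} [Semigroup S] (ρ : Con S) : Prop :=
  ∀ s e : S, ρ s e → IsIdempotentElem e → IsIdempotentElem s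

/-- An inverse semigroup is `E`-disjunctive if its only idempotent-pure congruence is equality
(`⊥` is the equality congruence). -/
def IsEDisjunctive (S : Type*) [Semigroup S] [IsInverseSemigroup S] : Prop :=
  ∀ ρ : Con S, ρ.IsIdempotentPure → ρ = ⊥

/-- A graph with vertex set `V` and edge set `E`: directed, with loops and multiple edges
allowed, of arbitrary cardinality. -/
structure DirectedMultigraph (V : Type u) (E : Type v) where
  /-- the source of an edge -/
  source : E → V
  /-- the range of an edge -/
  range : E → V

namespace DirectedMultigraph

/-- The generating symbols: the vertices `v`, the edges `e` and the formal inverses `e⁻¹`. -/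
inductive Generator (V : Type u) (E : Type v) : Type (max u v)
  | vertex (v : V) : Generator V E
  | edge (e : E) : Generator V E
  | edgeInv (e : E) : Generator V E

/-- A generating symbol, in the free semigroup with zero on the generating symbols. -/
def Generator.toFree {V : Type u} {E : Type v} (x : Generator V E) :
    WithZero (FreeSemigroup (Generator V E)) :=
  ((FreeSemigroup.of x : FreeSemigroup (Generator V E)) : WithZero _)

open Generator in
/-- The defining relations of the graph inverse semigroup. -/
inductive Rel {V : Type u} {E : Type v} (Γ : DirectedMultigraph V E) :
    WithZero (FreeSemigroup (Generator V E)) → WithZero (FreeSemigroup (Generator V E)) → Prop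
  | vertex_mul_self (v : V) :
      Rel Γ ((vertex v).toFree * (vertex v).toFree) (vertex v).toFree
  | vertex_mul_vertex (v w : V) (h : v ≠ w) :
      Rel Γ ((vertex v).toFree * (vertex w).toFree) 0
  | source_mul_edge (e : E) :
      Rel Γ ((vertex (Γ.source e)).toFree * (edge e).toFree) (edge e).toFree
  | edge_mul_range (e : E) :
      Rel Γ ((edge e).toFree * (vertex (Γ.range e)).toFree) (edge e).toFree
  | range_mul_edgeInv (e : E) :
      Rel Γ ((vertex (Γ.range e)).toFree * (edgeInv e).toFree) (edgeInv e).toFree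
  | edgeInv_mul_source (e : E) :
      Rel Γ ((edgeInv e).toFree * (vertex (Γ.source e)).toFree) (edgeInv e).toFree
  | edgeInv_mul_self (f : E) :
      Rel Γ ((edgeInv f).toFree * (edge f).toFree) (vertex (Γ.range f)).toFree
  | edgeInv_mul_edge (e f : E) (h : e ≠ f) :
      Rel Γ ((edgeInv e).toFree * (edge f).toFree) 0

/-- The graph inverse semigroup of `Γ`: the semigroup with zero generated by the vertices, the
edges and the inverse edges, subject to the relations `DirectedMultigraph.Rel`. -/
def GraphInverseSemigroup {V : Type u} {E : Type v} (Γ : DirectedMultigraph V E) :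
    Type (max u v) :=
  (conGen Γ.Rel).Quotient

instance {V : Type u} {E : Type v} (Γ : DirectedMultigraph V E) :
    Semigroup Γ.GraphInverseSemigroup :=
  inferInstanceAs (Semigroup (conGen Γ.Rel).Quotient)

/-- A vertex is isolated if it is neither the source nor the range of an edge. -/
def IsIsolated {V : Type u} {E : Type v} (Γ : DirectedMultigraph V E) (v : V) : Prop :=
  ∀ e : E, v ≠ Γ.source e ∧ v ≠ Γ.range e

/-- The set of out-edges of a vertex. -/
def outEdges {V : Type u} {E : Type v} (Γ : DirectedMultigraph V E) (v : V) : Set E :=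
  {e : E | Γ.source e = v}

/-! The rest of this section proves that the semigroup just defined is an inverse semigroup. -/

section Inverse

namespace GraphInverseSemigroup

/-- The class of an element of the free semigroup with zero. -/
def mk {V : Type u} {E : Type v} (Γ : DirectedMultigraph V E)
    (x : WithZero (FreeSemigroup (Generator V E))) : Γ.GraphInverseSemigroup :=
  (x : (conGen Γ.Rel).Quotient)

instance {V : Type u} {E : Type v} (Γ : DirectedMultigraph V E) :
    Zero Γ.GraphInverseSemigroup := ⟨mk Γ 0⟩

/-- The element given by a vertex. -/
def vert {V : Type u} {E : Type v} (Γ : DirectedMultigraph V E) (v : V) :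
    Γ.GraphInverseSemigroup := mk Γ (Generator.vertex v).toFree

/-- The element given by an edge. -/
def edge {V : Type u} {E : Type v} (Γ : DirectedMultigraph V E) (e : E) :
    Γ.GraphInverseSemigroup := mk Γ (Generator.edge e).toFree

/-- The element given by an inverse edge. -/
def edgeInv {V : Type u} {E : Type v} (Γ : DirectedMultigraph V E) (e : E) :
    Γ.GraphInverseSemigroup := mk Γ (Generator.edgeInv e).toFree

variable {V : Type u} {E : Type v} {Γ : DirectedMultigraph V E}

theorem mk_mul (x y : WithZero (FreeSemigroup (Generator V E))) :
    mk Γ (x * y) = mk Γ x * mk Γ y := rfl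

theorem mk_eq {x y : WithZero (FreeSemigroup (Generator V E))} (h : Γ.Rel x y) :
    mk Γ x = mk Γ y := (Con.eq _).2 (ConGen.Rel.of _ _ h)

theorem mk_surjective (x : Γ.GraphInverseSemigroup) : ∃ y, mk Γ y = x :=
  Con.induction_on x fun y => ⟨y, rfl⟩

instance : SemigroupWithZero Γ.GraphInverseSemigroup where
  zero_mul a := by
    obtain ⟨y, rfl⟩ := mk_surjective a
    change mk Γ 0 * mk Γ y = mk Γ 0
    rw [← mk_mul, zero_mul]
  mul_zero a := by
    obtain ⟨y, rfl⟩ := mk_surjective a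
    change mk Γ y * mk Γ 0 = mk Γ 0
    rw [← mk_mul, mul_zero]

theorem vert_mul_self (v : V) : vert Γ v * vert Γ v = vert Γ v :=
  mk_eq (Rel.vertex_mul_self v)

theorem vert_mul_vert {v w : V} (h : v ≠ w) : vert Γ v * vert Γ w = 0 :=
  mk_eq (Rel.vertex_mul_vertex v w h)

theorem source_mul_edge (e : E) : vert Γ (Γ.source e) * edge Γ e = edge Γ e :=
  mk_eq (Rel.source_mul_edge e)

theorem edge_mul_range (e : E) : edge Γ e * vert Γ (Γ.range e) = edge Γ e :=
  mk_eq (Rel.edge_mul_range e)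

theorem range_mul_edgeInv (e : E) : vert Γ (Γ.range e) * edgeInv Γ e = edgeInv Γ e :=
  mk_eq (Rel.range_mul_edgeInv e)

theorem edgeInv_mul_source (e : E) : edgeInv Γ e * vert Γ (Γ.source e) = edgeInv Γ e :=
  mk_eq (Rel.edgeInv_mul_source e)

theorem edgeInv_mul_self (e : E) : edgeInv Γ e * edge Γ e = vert Γ (Γ.range e) :=
  mk_eq (Rel.edgeInv_mul_self e)

theorem edgeInv_mul_edge {e f : E} (h : e ≠ f) : edgeInv Γ e * edge Γ f = 0 :=
  mk_eq (Rel.edgeInv_mul_edge e f h)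

/-- `IsPath u w p p'` says that `p` is the product of the edges of a path from `u` to `w` and
that `p'` is the product of their inverses in the reverse order. -/
inductive IsPath : V → V → Γ.GraphInverseSemigroup → Γ.GraphInverseSemigroup → Prop
  | nil (w : V) : IsPath w w (vert Γ w) (vert Γ w)
  | cons (e : E) {w : V} {p p' : Γ.GraphInverseSemigroup} (h : IsPath (Γ.range e) w p p') :
      IsPath (Γ.source e) w (edge Γ e * p) (p' * edgeInv Γ e)

namespace IsPath

variable {u w x y : V} {p p' q q' : Γ.GraphInverseSemigroup}

theorem vert_mul (h : IsPath u w p p') : vert Γ u * p = p := by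
  cases h with
  | nil => exact vert_mul_self _
  | cons e h => rw [← mul_assoc, source_mul_edge]

theorem mul_vert' (h : IsPath u w p p') : p' * vert Γ u = p' := by
  cases h with
  | nil => exact vert_mul_self _
  | cons e h => rw [mul_assoc, edgeInv_mul_source]

theorem mul_vert (h : IsPath u w p p') : p * vert Γ w = p := by
  induction h with
  | nil => exact vert_mul_self _
  | cons e h ih => rw [mul_assoc, ih]

theorem vert_mul' (h : IsPath u w p p') : vert Γ w * p' = p' := by
  induction h with
  | nil => exact vert_mul_self _
  | cons e h ih => rw [← mul_assoc, ih]

theorem inv_mul (h : IsPath u w p p') : p' * p = vert Γ w := by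
  induction h with
  | nil => exact vert_mul_self _
  | cons e h ih =>
    rw [mul_assoc, ← mul_assoc (edgeInv Γ e), edgeInv_mul_self, h.vert_mul, ih]

theorem comp (h : IsPath u w p p') (k : IsPath w x q q') : IsPath u x (p * q) (q' * p') := by
  induction h with
  | nil => rwa [k.vert_mul, k.mul_vert']
  | cons e h ih => rw [mul_assoc (edge Γ e), ← mul_assoc q']; exact (ih k).cons e

theorem trichotomy (h : IsPath u w p p') : ∀ {x y : V} {q q' : Γ.GraphInverseSemigroup},
    IsPath x y q q' → (p' * q = 0 ∧ q' * p = 0) ∨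
      (∃ t t', IsPath w y t t' ∧ q = p * t ∧ q' = t' * p') ∨
      (∃ t t', IsPath y w t t' ∧ p = q * t ∧ p' = t' * q') := by
  induction h with
  | nil w =>
    intro x y q q' k
    by_cases hx : w = x
    · subst hx
      exact Or.inr (Or.inl ⟨q, q', k, k.vert_mul.symm, k.mul_vert'.symm⟩)
    · left
      rw [← k.vert_mul, ← k.mul_vert', ← mul_assoc, mul_assoc q', vert_mul_vert hx,
        vert_mul_vert (Ne.symm hx), zero_mul, mul_zero]
      exact ⟨rfl, rfl⟩
  | @cons e w p p' h ih =>
    intro x y q q' k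
    cases k with
    | nil =>
      have k := h.cons e
      by_cases hx : Γ.source e = x
      · subst hx
        exact Or.inr (Or.inr ⟨_, _, k, k.vert_mul.symm, k.mul_vert'.symm⟩)
      · left
        rw [← k.vert_mul, ← k.mul_vert', mul_assoc _ _ (vert Γ x), ← mul_assoc (vert Γ x),
          vert_mul_vert hx, vert_mul_vert (Ne.symm hx), zero_mul, mul_zero]
        exact ⟨rfl, rfl⟩
    | @cons f _ q q' k =>
      by_cases hf : e = f
      · subst hf
        have h1 : p' * edgeInv Γ e * (edge Γ e * q) = p' * q := by
          rw [mul_assoc, ← mul_assoc (edgeInv Γ e), edgeInv_mul_self, k.vert_mul]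
        have h2 : q' * edgeInv Γ e * (edge Γ e * p) = q' * p := by
          rw [mul_assoc, ← mul_assoc (edgeInv Γ e), edgeInv_mul_self, h.vert_mul]
        rw [h1, h2]
        rcases ih k with h0 | ⟨t, t', ht, rfl, rfl⟩ | ⟨t, t', ht, rfl, rfl⟩
        · exact Or.inl h0
        · exact Or.inr (Or.inl ⟨t, t', ht, by rw [mul_assoc], by rw [mul_assoc]⟩)
        · exact Or.inr (Or.inr ⟨t, t', ht, by rw [mul_assoc], by rw [mul_assoc]⟩)
      · left
        rw [mul_assoc, ← mul_assoc (edgeInv Γ e), edgeInv_mul_edge hf, mul_assoc q',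
          ← mul_assoc (edgeInv Γ f), edgeInv_mul_edge (Ne.symm hf)]
        simp

end IsPath

/-- Every element is zero or of the form `p q⁻¹` with paths `p` and `q` of the same range. -/
theorem eq_zero_or_eq_mul (a : Γ.GraphInverseSemigroup) :
    a = 0 ∨ ∃ u w x p p' q q', IsPath u w p p' ∧ IsPath x w q q' ∧ a = p * q' := by
  obtain ⟨a, rfl⟩ := mk_surjective a
  induction a using WithZero.recZeroCoe with
  | zero => exact Or.inl rfl
  | coe a =>
    induction a using FreeSemigroup.recOnMul with
    | ih1 g =>
      right
      cases g with
      | vertex v => exact ⟨v, v, v, _, _, _, _, .nil v, .nil v, (vert_mul_self v).symm⟩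
      | edge e =>
        refine ⟨_, _, _, _, _, _, _, .cons e (.nil _), .nil _, ?_⟩
        rw [edge_mul_range, edge_mul_range]; rfl
      | edgeInv e =>
        refine ⟨_, _, _, _, _, _, _, .nil _, .cons e (.nil _), ?_⟩
        rw [range_mul_edgeInv, range_mul_edgeInv]; rfl
    | ih2 g b ha hb =>
      rw [WithZero.coe_mul, mk_mul]
      rcases ha with ha | ⟨u, w, x, p, p', q, q', hp, hq, ha⟩
      · left; rw [ha, zero_mul]
      rcases hb with hb | ⟨u₂, w₂, x₂, r, r', s, s', hr, hs, hb⟩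
      · left; rw [hb, mul_zero]
      rw [ha, hb]
      have hm : p * q' * (r * s') = p * (q' * r) * s' := by simp only [mul_assoc]
      rw [hm]
      rcases hq.trichotomy hr with h0 | ⟨t, t', ht, rfl, rfl⟩ | ⟨t, t', ht, rfl, rfl⟩
      · left; rw [h0.1, mul_zero, zero_mul]
      · right
        refine ⟨_, _, _, _, _, _, _, hp.comp ht, hs, ?_⟩
        rw [← mul_assoc q', hq.inv_mul, ht.vert_mul]
      · right
        refine ⟨_, _, _, _, _, _, _, hp, hs.comp ht, ?_⟩
        rw [mul_assoc t', hr.inv_mul, ht.mul_vert', mul_assoc]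

/-- Every idempotent is zero or of the form `p p⁻¹` with a path `p`. -/
theorem eq_of_isIdempotentElem {a : Γ.GraphInverseSemigroup} (ha : IsIdempotentElem a) :
    a = 0 ∨ ∃ u w p p', IsPath u w p p' ∧ a = p * p' := by
  rcases eq_zero_or_eq_mul a with h | ⟨u, w, x, p, p', q, q', hp, hq, rfl⟩
  · exact Or.inl h
  have ha : p * (q' * p) * q' = p * q' := by
    simpa only [IsIdempotentElem, mul_assoc] using ha
  rcases hq.trichotomy hp with h0 | ⟨t, t', ht, rfl, rfl⟩ | ⟨t, t', ht, rfl, rfl⟩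
  · left; rw [← ha, h0.1, mul_zero, zero_mul]
  · right
    refine ⟨_, _, _, _, hq, ?_⟩
    have h1 : q' * (q * t * (q' * (q * t)) * q') * q = t * t := by
      calc _ = q' * q * t * (q' * q * (t * (q' * q))) := by simp only [mul_assoc]
        _ = t * t := by rw [hq.inv_mul, ht.mul_vert, ht.vert_mul]
    have h2 : q' * (q * t * q') * q = t := by
      calc _ = q' * q * (t * (q' * q)) := by simp only [mul_assoc]
        _ = t := by rw [hq.inv_mul, ht.mul_vert, ht.vert_mul]
    have h3 : t = vert Γ w := by
      rw [ha, h2] at h1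
      rw [← ht.inv_mul]
      nth_rewrite 2 [h1]
      rw [← mul_assoc, ht.inv_mul, ht.vert_mul]
    rw [h3, hq.mul_vert]
  · right
    refine ⟨_, _, _, _, hp, ?_⟩
    have h1 : p' * (p * (t' * p' * p) * (t' * p')) * p = t' * t' := by
      calc _ = p' * p * t' * (p' * p) * (t' * (p' * p)) := by simp only [mul_assoc]
        _ = t' * t' := by simp only [hp.inv_mul, ht.mul_vert', ht.vert_mul']
    have h2 : p' * (p * (t' * p')) * p = t' := by
      calc _ = p' * p * (t' * (p' * p)) := by simp only [mul_assoc]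
        _ = t' := by rw [hp.inv_mul, ht.mul_vert', ht.vert_mul']
    have h3 : t' = vert Γ w := by
      rw [ha, h2] at h1
      rw [← ht.inv_mul]
      nth_rewrite 2 [h1]
      rw [mul_assoc, ht.inv_mul, ht.mul_vert']
    rw [h3, hp.vert_mul']

theorem mul_comm_of_isIdempotentElem {a b : Γ.GraphInverseSemigroup}
    (ha : IsIdempotentElem a) (hb : IsIdempotentElem b) : a * b = b * a := by
  rcases eq_of_isIdempotentElem ha with rfl | ⟨u, w, p, p', hp, rfl⟩
  · rw [zero_mul, mul_zero]
  rcases eq_of_isIdempotentElem hb with rfl | ⟨x, y, q, q', hq, rfl⟩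
  · rw [zero_mul, mul_zero]
  have h1 : p * p' * (q * q') = p * (p' * q) * q' := by simp only [mul_assoc]
  have h2 : q * q' * (p * p') = q * (q' * p) * p' := by simp only [mul_assoc]
  rw [h1, h2]
  rcases hp.trichotomy hq with h0 | ⟨t, t', ht, rfl, rfl⟩ | ⟨t, t', ht, rfl, rfl⟩
  · rw [h0.1, h0.2]; simp
  · rw [← mul_assoc p', hp.inv_mul, ht.vert_mul, mul_assoc t', hp.inv_mul, ht.mul_vert']
    simp only [mul_assoc]
  · rw [← mul_assoc q', hq.inv_mul, ht.vert_mul, mul_assoc t', hq.inv_mul, ht.mul_vert']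
    simp only [mul_assoc]

theorem exists_inverse (a : Γ.GraphInverseSemigroup) :
    ∃ b : Γ.GraphInverseSemigroup, a * b * a = a ∧ b * a * b = b := by
  rcases eq_zero_or_eq_mul a with rfl | ⟨u, w, x, p, p', q, q', hp, hq, rfl⟩
  · exact ⟨0, by simp, by simp⟩
  · refine ⟨q * p', ?_, ?_⟩
    · calc p * q' * (q * p') * (p * q') = p * (q' * q) * (p' * p) * q' := by
            simp only [mul_assoc]
        _ = p * q' := by rw [hq.inv_mul, hp.inv_mul, hp.mul_vert, hp.mul_vert]
    · calc q * p' * (p * q') * (q * p') = q * (p' * p) * (q' * q) * p' := by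
            simp only [mul_assoc]
        _ = q * p' := by rw [hq.inv_mul, hp.inv_mul, hq.mul_vert, hq.mul_vert]

end GraphInverseSemigroup

end Inverse

instance {V : Type u} {E : Type v} (Γ : DirectedMultigraph V E) :
    IsInverseSemigroup Γ.GraphInverseSemigroup where
  existsUnique_inverse a := by
    obtain ⟨b, hb1, hb2⟩ := GraphInverseSemigroup.exists_inverse a
    refine ⟨b, ⟨hb1, hb2⟩, ?_⟩
    rintro c ⟨hc1, hc2⟩
    have idl : ∀ d, a * d * a = a → IsIdempotentElem (a * d) := fun d h => by
      rw [IsIdempotentElem, ← mul_assoc, h]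
    have idr : ∀ d, a * d * a = a → IsIdempotentElem (d * a) := fun d h => by
      rw [IsIdempotentElem, mul_assoc, ← mul_assoc a, h]
    have e1 := GraphInverseSemigroup.mul_comm_of_isIdempotentElem (idl c hc1) (idl b hb1)
    have e2 := GraphInverseSemigroup.mul_comm_of_isIdempotentElem (idr c hc1) (idr b hb1)
    calc c = c * (a * b * a) * c := by rw [hb1, hc2]
      _ = c * a * (b * a) * c := by simp only [mul_assoc]
      _ = b * (a * c * a) * c := by rw [e2]; simp only [mul_assoc]
      _ = b * (a * b * a) * c := by rw [hc1, hb1]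
      _ = b * (a * b * (a * c)) := by simp only [mul_assoc]
      _ = b * (a * c * a) * b := by rw [← e1]; simp only [mul_assoc]
      _ = b := by rw [hc1, hb2]

end DirectedMultigraph

/-! Nonzero elements are products `p q⁻¹` of paths with a common range, and two paths are either
comparable as prefixes or satisfy `p⁻¹ q = q⁻¹ p = 0` (`IsPath.trichotomy`). Hence `p q⁻¹` is
idempotent only if `p = q` (`IsPath.eq_of_isIdempotentElem_mul_inv`).

Sufficiency. Let `ρ` be idempotent-pure. No edge with a sibling (another edge of the same source) is
related to `0`, as it is not idempotent; without isolated vertices, no vertex is then related to `0`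
either. Multiplying a related pair by `p⁻¹` and `q` turns `p q⁻¹` into a vertex. This excludes
incomparable paths and reduces the comparable cases to a vertex related to some `t t⁻¹`; if `t`
began with an edge `e`, multiplying by a sibling of `e` would relate that sibling to `0`.

Necessity. The syntactic congruence of the set of idempotents is idempotent-pure, so it suffices
that it identifies two distinct elements: an isolated vertex `v` with `0`, or the source of a sole
out-edge `e` with `e e⁻¹`. That these pairs are distinct is seen in a representation on functions on
paths. -/

namespace DirectedMultigraph

namespace GraphInverseSemigroup

/-! ### A representation separating vertices from `0` and from `e e⁻¹` -/

section Representation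

/-- The first vertex of a path, given by the list of its edges and its last vertex. -/
def startVertex {V : Type u} {E : Type v} (Γ : DirectedMultigraph V E) : List E × V → V
  | ([], w) => w
  | (e :: _, _) => Γ.source e

open Classical in
/-- The action of a generating symbol on integer-valued functions on the paths. -/
noncomputable def generatorAction {V : Type u} {E : Type v} (Γ : DirectedMultigraph V E) :
    Generator V E → Module.End ℤ (List E × V → ℤ)
  | .vertex v =>
    { toFun := fun φ x => if startVertex Γ x = v then φ x else 0
      map_add' := fun φ ψ => by ext x; by_cases h : startVertex Γ x = v <;> simp [h]
      map_smul' := fun c φ => by ext x; simp }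
  | .edge e =>
    { toFun := fun φ x => match x with
        | ([], _) => 0
        | (f :: l, w) => if f = e ∧ startVertex Γ (l, w) = Γ.range e then φ (l, w) else 0
      map_add' := fun φ ψ => by
        ext ⟨_ | ⟨f, l⟩, w⟩
        · simp
        · by_cases h : f = e ∧ startVertex Γ (l, w) = Γ.range e <;> simp [h]
      map_smul' := fun c φ => by ext ⟨_ | ⟨f, l⟩, w⟩ <;> simp }
  | .edgeInv e =>
    { toFun := fun φ x => if startVertex Γ x = Γ.range e then φ (e :: x.1, x.2) else 0
      map_add' := fun φ ψ => by ext x; by_cases h : startVertex Γ x = Γ.range e <;> simp [h]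
      map_smul' := fun c φ => by ext x; simp }

/-- The action of the free semigroup with zero on integer-valued functions on the paths. -/
noncomputable def freeAction {V : Type u} {E : Type v} (Γ : DirectedMultigraph V E) :
    WithZero (FreeSemigroup (Generator V E)) →ₙ* Module.End ℤ (List E × V → ℤ) where
  toFun := WithZero.recZeroCoe 0 (FreeSemigroup.lift (generatorAction Γ))
  map_mul' a b := by
    induction a using WithZero.recZeroCoe with
    | zero => simp
    | coe a =>
      induction b using WithZero.recZeroCoe with
      | zero => simp
      | coe b => exact map_mul (FreeSemigroup.lift (generatorAction Γ)) a b

variable {V : Type u} {E : Type v} {Γ : DirectedMultigraph V E}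

theorem freeAction_toFree (g : Generator V E) :
    freeAction Γ g.toFree = generatorAction Γ g := by
  simp [freeAction, Generator.toFree]

theorem freeAction_zero : freeAction Γ 0 = 0 := rfl

/-- The lists acted on need not be composable paths. The conditions on the first vertex in
`generatorAction` make the relations hold on all of them. -/
theorem freeAction_eq_of_rel {x y : WithZero (FreeSemigroup (Generator V E))}
    (h : Γ.Rel x y) : freeAction Γ x = freeAction Γ y := by
  cases h <;> simp only [map_mul, freeAction_toFree, freeAction_zero] <;>
    refine LinearMap.ext fun φ => funext fun x => ?_
  case vertex_mul_self => simp +contextual [generatorAction]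
  case vertex_mul_vertex v w h =>
    simp only [generatorAction, Module.End.mul_apply, LinearMap.coe_mk, AddHom.coe_mk,
      LinearMap.zero_apply, Pi.zero_apply]
    grind
  case source_mul_edge e =>
    obtain ⟨_ | ⟨f, l⟩, w⟩ := x <;>
      simp only [generatorAction, startVertex, Module.End.mul_apply, LinearMap.coe_mk,
        AddHom.coe_mk] <;> grind
  case edge_mul_range e =>
    obtain ⟨_ | ⟨f, l⟩, w⟩ := x <;>
      simp only [generatorAction, Module.End.mul_apply, LinearMap.coe_mk, AddHom.coe_mk]
    grind
  case range_mul_edgeInv => simp +contextual [generatorAction]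
  case edgeInv_mul_source => simp [generatorAction, startVertex]
  case edgeInv_mul_self e =>
    simp only [generatorAction, Module.End.mul_apply, LinearMap.coe_mk, AddHom.coe_mk]
    grind
  case edgeInv_mul_edge e f h => simp [generatorAction, h]

theorem freeAction_eq_of_mk_eq {x y : WithZero (FreeSemigroup (Generator V E))}
    (h : mk Γ x = mk Γ y) : freeAction Γ x = freeAction Γ y :=
  (Con.conGen_le (c := Con.ker (freeAction Γ))).2 (fun _ _ => freeAction_eq_of_rel)
    ((Con.eq _).1 h)

theorem vert_ne_zero (v : V) : vert Γ v ≠ 0 := by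
  intro h
  have h := freeAction_eq_of_mk_eq h
  rw [freeAction_toFree, freeAction_zero] at h
  have h := congrFun (LinearMap.congr_fun h (fun _ => 1)) ([], v)
  simp [generatorAction, startVertex] at h

/-- The trivial path at `v` tells them apart: any function in the image of `e` vanishes on trivial
paths. -/
theorem vert_ne_edge_mul_edgeInv (v : V) (e : E) : vert Γ v ≠ edge Γ e * edgeInv Γ e := by
  intro h
  have h := freeAction_eq_of_mk_eq (h.trans (mk_mul _ _).symm)
  rw [map_mul, freeAction_toFree, freeAction_toFree, freeAction_toFree] at h
  have h := congrFun (LinearMap.congr_fun h (fun _ => 1)) ([], v)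
  simp [generatorAction, startVertex] at h

end Representation

/-! ### Idempotents and paths -/

variable {V : Type u} {E : Type v} {Γ : DirectedMultigraph V E}

theorem edge_ne_zero (e : E) : edge Γ e ≠ 0 := fun h =>
  vert_ne_zero (Γ.range e) (by rw [← edgeInv_mul_self, h, mul_zero])

theorem isIdempotentElem_zero : IsIdempotentElem (0 : Γ.GraphInverseSemigroup) :=
  mul_zero 0

theorem isIdempotentElem_mul {a b : Γ.GraphInverseSemigroup}
    (ha : IsIdempotentElem a) (hb : IsIdempotentElem b) : IsIdempotentElem (a * b) :=
  ha.mul_of_commute (mul_comm_of_isIdempotentElem ha hb) hb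

/-- An edge is not idempotent if there is another edge with the same source. -/
theorem not_isIdempotentElem_edge {e f : E} (hf : f ≠ e) (hs : Γ.source f = Γ.source e) :
    ¬ IsIdempotentElem (edge Γ e) := by
  intro he
  have h1 : vert Γ (Γ.range e) * edge Γ e = vert Γ (Γ.range e) := by
    rw [← edgeInv_mul_self, mul_assoc, he.eq]
  -- If `e` is a loop, it equals its own vertex, so it fixes `f`; but `e⁻¹ f = 0` then forces `f =
  -- 0`. Otherwise `r(e) e = 0`, so `r(e) = 0`.
  by_cases h : Γ.range e = Γ.source e
  · rw [h, source_mul_edge] at h1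
    refine edge_ne_zero (Γ := Γ) f ?_
    calc edge Γ f = edge Γ e * edge Γ f := by rw [h1, ← hs, source_mul_edge]
      _ = vert Γ (Γ.range e) * edge Γ f := by rw [h1, h]
      _ = 0 := by rw [← edgeInv_mul_self, mul_assoc, h1, ← hs, source_mul_edge,
        edgeInv_mul_edge hf.symm]
  · rw [← source_mul_edge, ← mul_assoc, vert_mul_vert h, zero_mul] at h1
    exact vert_ne_zero _ h1.symm

namespace IsPath

variable {u w x : V} {p p' q q' : Γ.GraphInverseSemigroup}

theorem isIdempotentElem_mul (h : IsPath u w p p') : IsIdempotentElem (p * p') := by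
  rw [IsIdempotentElem, mul_assoc, ← mul_assoc p', h.inv_mul, h.vert_mul']

theorem edge (e : E) : IsPath (Γ.source e) (Γ.range e) (edge Γ e) (edgeInv Γ e) := by
  simpa only [edge_mul_range, range_mul_edgeInv] using (nil (Γ.range e)).cons e

/-- A path with product `p` is trivial if `p` or `p⁻¹` is idempotent. -/
theorem eq_vert_of_isIdempotentElem (h : IsPath u w p p')
    (hp : IsIdempotentElem p ∨ IsIdempotentElem p') : p = vert Γ w ∧ p' = vert Γ w := by
  by_cases huw : w = u
  · subst huw
    rcases hp with hp | hp
    · have h1 : p = vert Γ w := by rw [← h.vert_mul, ← h.inv_mul, mul_assoc, hp.eq]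
      exact ⟨h1, by rw [← h.inv_mul, h1, h.mul_vert']⟩
    · have h1 : p' = vert Γ w := by rw [← h.mul_vert', ← h.inv_mul, ← mul_assoc, hp.eq]
      exact ⟨by rw [← h.inv_mul, h1, h.vert_mul], h1⟩
  · exfalso
    have h1 : p * p = 0 := by
      rw [← h.mul_vert, mul_assoc, ← mul_assoc (vert Γ w), ← h.vert_mul,
        ← mul_assoc (vert Γ w), vert_mul_vert huw, zero_mul, zero_mul, mul_zero]
    have h2 : p' * p' = 0 := by
      rw [← h.mul_vert', mul_assoc, ← mul_assoc (vert Γ u), ← h.vert_mul',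
        ← mul_assoc (vert Γ u), vert_mul_vert (Ne.symm huw), zero_mul, zero_mul, mul_zero]
    refine vert_ne_zero (Γ := Γ) w ?_
    rcases hp with hp | hp
    · rw [← h.inv_mul, ← hp.eq, h1, mul_zero]
    · rw [← h.inv_mul, ← hp.eq, h2, zero_mul]

/-- Conjugating back by `p⁻¹` recovers `a`, since `p⁻¹ p` is the vertex `w`, which acts as an
identity on `a`. -/
theorem isIdempotentElem_of_conj (h : IsPath u w p p') {a : Γ.GraphInverseSemigroup}
    (ha : vert Γ w * a = a) (ha' : a * vert Γ w = a) (hi : IsIdempotentElem (p * a * p')) :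
    IsIdempotentElem a := by
  have key : p' * (p * a * p') * p = a := by
    calc _ = p' * p * a * (p' * p) := by simp only [mul_assoc]
      _ = a := by rw [h.inv_mul, ha, ha']
  calc a * a = p' * p * a * (p' * p) * a * (p' * p) := by rw [h.inv_mul, ha, ha', mul_assoc, ha']
    _ = p' * (p * a * p' * (p * a * p')) * p := by simp only [mul_assoc]
    _ = a := by rw [hi.eq, key]

theorem inv_mul_mul_mul (hp : IsPath u w p p') (hq : IsPath x w q q') :
    p' * (p * q') * q = vert Γ w := by
  rw [← mul_assoc p', hp.inv_mul, hq.vert_mul', hq.inv_mul]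

/-- If `p q⁻¹` is idempotent, then the paths `p` and `q` are equal. -/
theorem eq_of_isIdempotentElem_mul_inv (hp : IsPath u w p p') (hq : IsPath x w q q')
    (h : IsIdempotentElem (p * q')) : p = q ∧ p' = q' := by
  rcases hp.trichotomy hq with h0 | ⟨t, t', ht, rfl, rfl⟩ | ⟨t, t', ht, rfl, rfl⟩
  -- For incomparable paths the square of `p q⁻¹` is `0`, so `p q⁻¹` and hence `p⁻¹ (p q⁻¹) q = w`
  -- would vanish.
  · refine absurd ?_ (vert_ne_zero (Γ := Γ) w)
    rw [← hp.inv_mul_mul_mul hq, ← h.eq, mul_assoc p q', ← mul_assoc q' p, h0.2]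
    simp
  · have hi := hp.isIdempotentElem_of_conj ht.vert_mul' ht.mul_vert' (by rwa [mul_assoc])
    obtain ⟨h1, h2⟩ := ht.eq_vert_of_isIdempotentElem (Or.inr hi)
    rw [h1, h2, hp.mul_vert, hp.vert_mul']
    exact ⟨rfl, rfl⟩
  · have hi := hq.isIdempotentElem_of_conj ht.vert_mul ht.mul_vert h
    obtain ⟨h1, h2⟩ := ht.eq_vert_of_isIdempotentElem (Or.inl hi)
    rw [h1, h2, hq.mul_vert, hq.vert_mul']
    exact ⟨rfl, rfl⟩

/-- A path is trivial or starts with an edge. -/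
theorem eq_vert_or_exists_edge (h : IsPath u w p p') :
    (w = u ∧ p = vert Γ u ∧ p' = vert Γ u) ∨
      ∃ e m m', u = Γ.source e ∧ IsPath (Γ.range e) w m m' ∧
        p = GraphInverseSemigroup.edge Γ e * m ∧ p' = m' * edgeInv Γ e := by
  cases h with
  | nil => exact Or.inl ⟨rfl, rfl, rfl⟩
  | cons e h => exact Or.inr ⟨e, _, _, rfl, h, rfl, rfl⟩

theorem eq_vert_of_forall_ne_range (h : IsPath u w p p') (hw : ∀ e, w ≠ Γ.range e) :
    u = w ∧ p = vert Γ w ∧ p' = vert Γ w := by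
  induction h with
  | nil => exact ⟨rfl, rfl, rfl⟩
  | cons e h ih => exact absurd (ih hw).1.symm (hw e)

end IsPath

/-! ### Sufficiency: idempotent-pure congruences are trivial -/

section IdempotentPure

variable {ρ : Con Γ.GraphInverseSemigroup}

theorem not_con_edge_zero (hρ : ρ.IsIdempotentPure)
    (hE : ∀ e, ∃ f, f ≠ e ∧ Γ.source f = Γ.source e) (e : E) : ¬ ρ (edge Γ e) 0 := by
  intro h
  obtain ⟨f, hf, hs⟩ := hE e
  exact not_isIdempotentElem_edge hf hs (hρ _ _ h isIdempotentElem_zero)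

theorem not_con_vert_zero (hρ : ρ.IsIdempotentPure) (hV : ∀ v, ¬ Γ.IsIsolated v)
    (hE : ∀ e, ∃ f, f ≠ e ∧ Γ.source f = Γ.source e) (v : V) : ¬ ρ (vert Γ v) 0 := by
  intro h
  refine hV v fun e => ⟨?_, ?_⟩
  · rintro rfl
    refine not_con_edge_zero hρ hE e ?_
    simpa only [source_mul_edge, zero_mul] using ρ.mul h (ρ.refl (edge Γ e))
  · rintro rfl
    refine not_con_edge_zero hρ hE e ?_
    simpa only [edge_mul_range, mul_zero] using ρ.mul (ρ.refl (edge Γ e)) h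

theorem eq_zero_of_con_zero (hρ : ρ.IsIdempotentPure) (hV : ∀ v, ¬ Γ.IsIsolated v)
    (hE : ∀ e, ∃ f, f ≠ e ∧ Γ.source f = Γ.source e) {a : Γ.GraphInverseSemigroup}
    (h : ρ a 0) : a = 0 := by
  rcases eq_zero_or_eq_mul a with h0 | ⟨u, w, x, p, p', q, q', hp, hq, rfl⟩
  · exact h0
  · refine absurd ?_ (not_con_vert_zero hρ hV hE w)
    simpa only [hp.inv_mul_mul_mul hq, mul_zero, zero_mul] using
      ρ.mul (ρ.mul (ρ.refl p') h) (ρ.refl q)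

/-- If `t` starts with `e`, a second edge `f` at the same vertex gives `w f = f` but `t t⁻¹ f = 0`,
so `f` would be related to `0`. -/
theorem IsPath.eq_vert_of_con (hρ : ρ.IsIdempotentPure)
    (hE : ∀ e, ∃ f, f ≠ e ∧ Γ.source f = Γ.source e) {w x : V}
    {t t' : Γ.GraphInverseSemigroup} (ht : IsPath w x t t') (h : ρ (vert Γ w) (t * t')) :
    t = vert Γ w ∧ t' = vert Γ w := by
  rcases ht.eq_vert_or_exists_edge with h0 | ⟨e, m, m', rfl, hm, rfl, rfl⟩
  · exact h0.2
  · obtain ⟨f, hf, hs⟩ := hE e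
    refine absurd ?_ (not_con_edge_zero hρ hE f)
    have h1 := ρ.mul h (ρ.refl (GraphInverseSemigroup.edge Γ f))
    rwa [← hs, source_mul_edge, mul_assoc, mul_assoc m', edgeInv_mul_edge hf.symm, mul_zero,
      mul_zero] at h1

/-- The case of `isEDisjunctive` in which one left-hand path is a prefix of the other. Comparing `q`
with `s` settles it, since `t s⁻¹ q` is related to a vertex and so is idempotent. -/
theorem eq_of_con_of_isPath (hρ : ρ.IsIdempotentPure) (hV : ∀ v, ¬ Γ.IsIsolated v)
    (hE : ∀ e, ∃ f, f ≠ e ∧ Γ.source f = Γ.source e) {u w x y z : V}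
    {p p' q q' s s' t t' : Γ.GraphInverseSemigroup} (hp : IsPath u w p p')
    (hq : IsPath x w q q') (ht : IsPath w z t t') (hs : IsPath y z s s')
    (h : ρ (p * q') (p * t * s')) : p * q' = p * t * s' := by
  have hw : ρ (vert Γ w) (t * (s' * q)) := by
    have h1 := ρ.mul (ρ.mul (ρ.refl p') h) (ρ.refl q)
    have h2 : p' * (p * t * s') * q = t * (s' * q) := by
      rw [← mul_assoc p', ← mul_assoc p', hp.inv_mul, ht.vert_mul, mul_assoc]
    rwa [hp.inv_mul_mul_mul hq, h2] at h1
  have hi := hρ _ _ (ρ.symm hw) (vert_mul_self w)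
  rcases hq.trichotomy hs with h0 | ⟨k, k', hk, rfl, rfl⟩ | ⟨k, k', hk, rfl, rfl⟩
  · rw [h0.2, mul_zero] at hw
    exact absurd hw (not_con_vert_zero hρ hV hE w)
  · rw [mul_assoc k', hq.inv_mul, hk.mul_vert'] at hw hi
    obtain ⟨rfl, rfl⟩ := ht.eq_of_isIdempotentElem_mul_inv hk hi
    obtain ⟨h1, h2⟩ := ht.eq_vert_of_con hρ hE hw
    rw [h1, h2, hp.mul_vert, hq.vert_mul']
  -- Here `q = s k`, and the path `t k` is idempotent, hence trivial; so `k⁻¹ = t` and `q⁻¹ = t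
  -- s⁻¹`.
  · rw [← mul_assoc s', hs.inv_mul, hk.vert_mul] at hi
    have h1 := ((ht.comp hk).eq_vert_of_isIdempotentElem (Or.inl hi)).2
    have h2 : k' = t := by
      rw [← hk.mul_vert', ← ht.inv_mul, ← mul_assoc, h1, ht.vert_mul]
    rw [h2, mul_assoc]

/-- If no vertex is isolated and no edge is the only edge with its source, then the graph inverse
semigroup is `E`-disjunctive. -/
theorem isEDisjunctive (hV : ∀ v, ¬ Γ.IsIsolated v)
    (hE : ∀ e, ∃ f, f ≠ e ∧ Γ.source f = Γ.source e) :
    IsEDisjunctive Γ.GraphInverseSemigroup := by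
  intro ρ hρ
  refine le_bot_iff.1 fun a b h => ?_
  change a = b
  rcases eq_zero_or_eq_mul a with rfl | ⟨u, w, x, p, p', q, q', hp, hq, rfl⟩
  · exact (eq_zero_of_con_zero hρ hV hE (ρ.symm h)).symm
  rcases eq_zero_or_eq_mul b with rfl | ⟨y, z, y₂, r, r', s, s', hr, hs, rfl⟩
  · exact eq_zero_of_con_zero hρ hV hE h
  rcases hp.trichotomy hr with h0 | ⟨t, t', ht, rfl, rfl⟩ | ⟨t, t', ht, rfl, rfl⟩
  · refine absurd ?_ (not_con_vert_zero hρ hV hE w)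
    have h1 := ρ.mul (ρ.mul (ρ.refl p') h) (ρ.refl q)
    rwa [hp.inv_mul_mul_mul hq, ← mul_assoc p', h0.1, zero_mul, zero_mul] at h1
  · exact eq_of_con_of_isPath hρ hV hE hp hq ht hs h
  · exact (eq_of_con_of_isPath hρ hV hE hr hs ht hq (ρ.symm h)).symm

end IdempotentPure

/-! ### Necessity: the syntactic congruence of the idempotents -/

section Syntactic

/-- The syntactic congruence of the set of idempotents. -/
def syntacticCon (Γ : DirectedMultigraph V E) : Con Γ.GraphInverseSemigroup where
  r a b := ∀ x y, IsIdempotentElem (x * a * y) ↔ IsIdempotentElem (x * b * y)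
  iseqv := ⟨fun _ _ _ => Iff.rfl, fun h x y => (h x y).symm,
    fun h k x y => (h x y).trans (k x y)⟩
  mul' {a b c d} h k x y := by
    have h1 := h x (c * y)
    have h2 := k (x * b) y
    simp only [mul_assoc] at h1 h2 ⊢
    exact h1.trans h2

theorem isIdempotentPure_syntacticCon : (syntacticCon Γ).IsIdempotentPure := by
  intro s e h he
  obtain ⟨b, hb, -⟩ := exists_inverse s
  have h1 : IsIdempotentElem (s * b) := by rw [IsIdempotentElem, ← mul_assoc, hb]
  have h2 : IsIdempotentElem (b * s) := by rw [IsIdempotentElem, mul_assoc, ← mul_assoc s, hb]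
  -- The context `s b _ b s` fixes `s` and sends the idempotent `e` to a product of idempotents.
  have h3 := (h (s * b) (b * s)).2 (isIdempotentElem_mul (isIdempotentElem_mul h1 he) h2)
  rwa [hb, ← mul_assoc, hb] at h3

/-- Syntactic equivalence is equality in an `E`-disjunctive graph inverse semigroup. -/
theorem eq_of_syntacticCon (h : IsEDisjunctive Γ.GraphInverseSemigroup)
    {a b : Γ.GraphInverseSemigroup} (hab : syntacticCon Γ a b) : a = b := by
  rw [h _ isIdempotentPure_syntacticCon] at hab
  exact hab

theorem mul_vert_eq_zero_or (x : Γ.GraphInverseSemigroup) (v : V) :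
    x * vert Γ v = 0 ∨
      ∃ u w p p' q q', IsPath u w p p' ∧ IsPath v w q q' ∧ x * vert Γ v = p * q' := by
  rcases eq_zero_or_eq_mul x with rfl | ⟨u, w, y, p, p', q, q', hp, hq, rfl⟩
  · exact Or.inl (zero_mul _)
  by_cases hy : y = v
  · subst hy
    exact Or.inr ⟨_, _, _, _, _, _, hp, hq, by rw [mul_assoc, hq.mul_vert']⟩
  · left
    rw [← hq.mul_vert', mul_assoc, mul_assoc, vert_mul_vert hy, mul_zero, mul_zero]

theorem vert_mul_eq_zero_or (x : Γ.GraphInverseSemigroup) (v : V) :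
    vert Γ v * x = 0 ∨
      ∃ u w p p' q q', IsPath v w p p' ∧ IsPath u w q q' ∧ vert Γ v * x = p * q' := by
  rcases eq_zero_or_eq_mul x with rfl | ⟨y, w, u, p, p', q, q', hp, hq, rfl⟩
  · exact Or.inl (mul_zero _)
  by_cases hy : v = y
  · subst hy
    exact Or.inr ⟨_, _, _, _, _, _, hp, hq, by rw [← mul_assoc, hp.vert_mul]⟩
  · left
    rw [← hp.vert_mul, ← mul_assoc, ← mul_assoc, vert_mul_vert hy, zero_mul, zero_mul]

theorem mul_vert_mul (x y : Γ.GraphInverseSemigroup) (v : V) :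
    x * vert Γ v * y = x * vert Γ v * (vert Γ v * y) := by
  rw [mul_assoc x, mul_assoc x, ← mul_assoc (vert Γ v) (vert Γ v), vert_mul_self]

/-- No nontrivial path starts or ends at `v`, so `x v y` is always `0` or `v`, both idempotent. -/
theorem syntacticCon_vert_zero {v : V} (hv : Γ.IsIsolated v) :
    syntacticCon Γ (vert Γ v) 0 := by
  intro x y
  have h1 : x * vert Γ v = 0 ∨ x * vert Γ v = vert Γ v := by
    refine (mul_vert_eq_zero_or x v).imp_right ?_
    rintro ⟨u, w, p, p', q, q', hp, hq, h⟩
    rcases hq.eq_vert_or_exists_edge with ⟨rfl, rfl, rfl⟩ | ⟨e, -, -, he, -⟩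
    · rw [h, (hp.eq_vert_of_forall_ne_range fun e => (hv e).2).2.1, vert_mul_self]
    · exact absurd he (hv e).1
  have h2 : vert Γ v * y = 0 ∨ vert Γ v * y = vert Γ v := by
    refine (vert_mul_eq_zero_or y v).imp_right ?_
    rintro ⟨u, w, p, p', q, q', hp, hq, h⟩
    rcases hp.eq_vert_or_exists_edge with ⟨rfl, rfl, rfl⟩ | ⟨e, -, -, he, -⟩
    · rw [h, (hq.eq_vert_of_forall_ne_range fun e => (hv e).2).2.2, vert_mul_self]
    · exact absurd he (hv e).1
  refine iff_of_true ?_ (by simpa using isIdempotentElem_zero)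
  rw [mul_vert_mul]
  rcases h1 with h1 | h1 <;> rcases h2 with h2 | h2 <;> rw [h1, h2] <;>
    simp [IsIdempotentElem, vert_mul_self]

/-- The idempotents form an order ideal. -/
theorem isIdempotentElem_mul_mul {x y f : Γ.GraphInverseSemigroup} (hf : IsIdempotentElem f)
    (h : IsIdempotentElem (x * y)) : IsIdempotentElem (x * f * y) := by
  obtain ⟨b, hb, -⟩ := exists_inverse y
  have h1 : IsIdempotentElem (y * b) := by rw [IsIdempotentElem, ← mul_assoc, hb]
  have hc := mul_comm_of_isIdempotentElem h1 hf
  -- Moving `f` to the right past `y` gives `x f y = (x y)(b f y)`, a product of two idempotents.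
  have h2 : y * (b * f * y) = f * y := by
    calc _ = y * b * f * y := by simp only [mul_assoc]
      _ = f * y := by rw [hc, mul_assoc, hb]
  have h3 : IsIdempotentElem (b * f * y) := by
    rw [IsIdempotentElem, mul_assoc, h2, mul_assoc, ← mul_assoc f, hf.eq, mul_assoc]
  have h4 := isIdempotentElem_mul h h3
  rwa [mul_assoc, h2, ← mul_assoc] at h4

theorem IsPath.eq_vert_of_mul_edge {e : E} (he : ∀ f, Γ.source f = Γ.source e → f = e)
    {t t' : Γ.GraphInverseSemigroup} (ht : IsPath (Γ.source e) (Γ.source e) t t')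
    (h : t * GraphInverseSemigroup.edge Γ e = GraphInverseSemigroup.edge Γ e) :
    t = vert Γ (Γ.source e) ∧ t' = vert Γ (Γ.source e) := by
  refine ht.eq_vert_of_isIdempotentElem (Or.inl ?_)
  rcases ht.eq_vert_or_exists_edge with ⟨-, rfl, -⟩ | ⟨f, m, m', hf, hm, rfl, rfl⟩
  · exact vert_mul_self _
  -- The path must start with the sole out-edge, so `t = e m` and `t t = (t e) m = e m = t`.
  · obtain rfl := he f hf.symm
    rw [IsIdempotentElem, ← mul_assoc, h]

/-- The paths are comparable, since otherwise `e = 0`. Their difference `t` is a closed path with `t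
e = e`, hence trivial. -/
theorem IsPath.eq_of_mul_edge {e : E} (he : ∀ f, Γ.source f = Γ.source e → f = e) {u x : V}
    {p p' q q' : Γ.GraphInverseSemigroup} (hp : IsPath u (Γ.source e) p p')
    (hq : IsPath x (Γ.source e) q q')
    (h : p * GraphInverseSemigroup.edge Γ e = q * GraphInverseSemigroup.edge Γ e) :
    p' = q' := by
  rcases hp.trichotomy hq with h0 | ⟨t, t', ht, rfl, rfl⟩ | ⟨t, t', ht, rfl, rfl⟩
  · refine absurd ?_ (edge_ne_zero (Γ := Γ) e)
    rw [← source_mul_edge, ← hp.inv_mul, mul_assoc, h, ← mul_assoc, h0.1, zero_mul]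
  · rw [(ht.eq_vert_of_mul_edge he ?_).2, hp.vert_mul']
    rw [← ht.vert_mul, ← hp.inv_mul, mul_assoc p', mul_assoc, ← h, ← mul_assoc, hp.inv_mul,
      source_mul_edge]
  · rw [(ht.eq_vert_of_mul_edge he ?_).2, hq.vert_mul']
    rw [← ht.vert_mul, ← hq.inv_mul, mul_assoc q', mul_assoc, h, ← mul_assoc, hq.inv_mul,
      source_mul_edge]

theorem syntacticCon_vert_edge_mul_edgeInv {e : E}
    (he : ∀ f, Γ.source f = Γ.source e → f = e) :
    syntacticCon Γ (vert Γ (Γ.source e)) (edge Γ e * edgeInv Γ e) := by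
  intro x y
  have hf := (IsPath.edge (Γ := Γ) e).isIdempotentElem_mul
  have hxy : x * (edge Γ e * edgeInv Γ e) * y =
      x * vert Γ (Γ.source e) * (edge Γ e * edgeInv Γ e) * (vert Γ (Γ.source e) * y) := by
    calc _ = x * (vert Γ (Γ.source e) * edge Γ e) *
          (edgeInv Γ e * vert Γ (Γ.source e)) * y := by
          rw [source_mul_edge, edgeInv_mul_source,
            mul_assoc x (edge Γ e) (edgeInv Γ e)]
      _ = _ := by simp only [mul_assoc]
  rw [hxy, mul_vert_mul]
  refine ⟨isIdempotentElem_mul_mul hf, ?_⟩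
  rcases mul_vert_eq_zero_or x (Γ.source e) with h | ⟨u, w, p, p', q, q', hp, hq, h⟩
  · simp [h]
  rcases vert_mul_eq_zero_or y (Γ.source e) with k | ⟨z, w₂, r, r', s, s', hr, hs, k⟩
  · simp [k]
  rw [h, k]
  -- If `q` or `r` is nontrivial it starts with `e`, and `e e⁻¹` is absorbed. If both are trivial,
  -- the element is `(p e)(s e)⁻¹`; its idempotency gives `p e = s e`, and `e` cancels.
  rcases hq.eq_vert_or_exists_edge with ⟨rfl, rfl, rfl⟩ | ⟨f, m, m', hf, hm, rfl, rfl⟩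
  · rcases hr.eq_vert_or_exists_edge with ⟨rfl, rfl, rfl⟩ | ⟨f, m, m', hf, hm, rfl, rfl⟩
    · rw [hp.mul_vert, hs.vert_mul']
      intro hi
      have h1 := (hp.comp (.edge e)).eq_of_isIdempotentElem_mul_inv (hs.comp (.edge e))
        (by simpa only [mul_assoc] using hi)
      rw [← hp.eq_of_mul_edge he hs h1.1]
      exact hp.isIdempotentElem_mul
    · obtain rfl := he f hf.symm
      have h1 : edge Γ f * edgeInv Γ f * (edge Γ f * m * s') = edge Γ f * m * s' := by
        calc _ = edge Γ f * (edgeInv Γ f * edge Γ f) * m * s' := by simp only [mul_assoc]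
          _ = _ := by rw [edgeInv_mul_self, edge_mul_range]
      rw [mul_assoc _ (_ * _) (_ * _ * _), h1]
      exact id
  · obtain rfl := he f hf.symm
    have h1 : p * (m' * edgeInv Γ f) * (edge Γ f * edgeInv Γ f) = p * (m' * edgeInv Γ f) := by
      calc _ = p * (m' * ((edgeInv Γ f * edge Γ f) * edgeInv Γ f)) := by simp only [mul_assoc]
        _ = _ := by rw [edgeInv_mul_self, range_mul_edgeInv]
    rw [h1]
    exact id

end Syntactic

end GraphInverseSemigroup

end DirectedMultigraph

open DirectedMultigraph GraphInverseSemigroup in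
theorem mainTheorem5 {V : Type u} {E : Type v} (Γ : DirectedMultigraph V E) :
    IsEDisjunctive Γ.GraphInverseSemigroup ↔
      (∀ x : V, ¬ Γ.IsIsolated x) ∧
        ∀ x : V, (Γ.outEdges x).encard = 0 ∨ 2 ≤ (Γ.outEdges x).encard := by
  refine ⟨fun h => ⟨fun x hx => ?_, fun x => ?_⟩, fun ⟨hV, hE⟩ => isEDisjunctive hV fun e => ?_⟩
  · exact vert_ne_zero x (eq_of_syntacticCon h (syntacticCon_vert_zero hx))
  · by_contra! hx
    have h1 : (Γ.outEdges x).encard = 1 :=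
      le_antisymm (Order.le_of_lt_add_one (one_add_one_eq_two (R := ℕ∞) ▸ hx.2))
        (Order.one_le_iff_ne_zero.2 hx.1)
    obtain ⟨e, he⟩ := Set.encard_eq_one.1 h1
    obtain rfl : Γ.source e = x := (Set.ext_iff.1 he e).2 rfl
    exact vert_ne_edge_mul_edgeInv _ e (eq_of_syntacticCon h
      (syntacticCon_vert_edge_mul_edgeInv fun f hf => (Set.ext_iff.1 he f).1 hf))
  · have he : e ∈ Γ.outEdges (Γ.source e) := rfl
    rcases hE (Γ.source e) with h0 | h2
    · rw [Set.encard_eq_zero.1 h0] at he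
      exact absurd he (Set.notMem_empty e)
    · obtain ⟨f, hf, hne⟩ := (Set.one_lt_encard_iff_nontrivial.1
        (lt_of_lt_of_le (by norm_num) h2)).exists_ne e
      exact ⟨f, hne, hf⟩
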